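/- Let $(\Omega,\mathcal F,\mathbb P)$ be a probability space, let $T\ge 1$, $d,n\ge 0$ be integers, and let $\mathbb F=(\mathcal F_t)_{t=0,\dots,T}$ be a filtration of sub-$\sigma$-algebras of $\mathcal F$. Let $$\mathcal A=\{(\vartheta_0,\dots,\vartheta_{T-1}) : \vartheta_t\in L^0(\Omega,\mathcal F_t,\mathbb P;\mathbb R^d)\ \text{for } t=0,\dots,T-1\}$$ be the set of strategies. A market model is a map $\widehat V:\mathcal A\to L^0(\mathcal F;\mathbb R^n\cup\{-\infty\})$ such that $\widehat V(0)=0$ a.s. and such that, for all $t\in\{0,\dots,T-1\}$, $A\in\mathcal F_t$ and $\vartheta\in\mathcal A$, $$\widehat V(\vartheta_0,\dots,\vartheta_{T-1})=\widehat V(\vartheta_0,\dots,\vartheta_{t-1},\vartheta_t\mathbf 1_A,\vartheta_{t+1},\dots,\vartheta_{T-1})\quad\text{a.s. on } A .$$ Here $\mathbb R^n\cup\{-\infty\}$ carries the $\sigma$-algebra of all sets $S$ for which $S\cap\mathbb R^n$ is Borel. Let $K$ be a map that assigns to each $\omega\in\Omega$ a closed convex cone $K(\omega)\subseteq\mathbb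 R^n$ (containing $0$), such that $\{\omega : K(\omega)\cap U\neq\varnothing\}\in\mathcal F$ for every open $U\subseteq\mathbb R^n$, and $\operatorname{int}K(\omega)\ne\varnothing$ for almost every $\omega$. Write $K^\circ(\omega)=\{y\in\mathbb R^n : \langle x,y\rangle\ge 0\ \ \forall x\in K(\omega)\}$, and let $L^0(\mathcal F;\operatorname{ri}K^\circ)$ be the set of $\mathcal F$-measurable maps $Z:\Omega\to\mathbb R^n$ with $Z(\omega)\in\operatorname{ri}K^\circ(\omega)$ for all $\omega$, where $\operatorname{ri}$ denotes the relative interior. Put $\langle z,-\infty\rangle=-\infty$ for every $z\in\mathbb R^n$. For $a,b\in\mathbb R^n$ write $a\succeq_{K(\omega)}b$ if $a-b\in K(\omega)$; moreover $a\succeq_{K(\omega)}-\infty$ for every $a\in\mathbb R^n\cup\{-\infty\}$, while $-\infty\succeq_{K(\omega)}b$ holds for no $b\in\mathbb R^n$. Write $a\sim_{K(\omega)}b$ if $a\succeq_{K(\omega)}b$ and $b\succeq_{K(\omega)}a$. Assume that the market model $\widehat V$ is upper semicontinuous in the following sense: for every $Z\in L^0(\mathcal F;\operatorname{ri}K^\circ)$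 and every sequence of essentially bounded strategies $\vartheta^k\in\mathcal A\cap L^\infty$ that converges in $L^\infty$ to a strategy $\vartheta\in\mathcal A$, $$\limsup_{k\to\infty}\,\langle Z,\widehat V(\vartheta^k)\rangle\le\langle Z,\widehat V(\vartheta)\rangle\quad\text{a.s.}$$ Then there exists a map $V:\Omega\times\mathbb R^{dT}\to\mathbb R^n\cup\{-\infty\}$, measurable with respect to $\mathcal F\otimes\mathcal B(\mathbb R^{dT})$, such that for every $\vartheta\in\mathcal A$ $$\widehat V(\vartheta)(\omega)\sim_{K(\omega)}V(\omega,\vartheta(\omega))\qquad\text{for almost every }\omega .$$ -/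

import Mathlib

open MeasureTheory Filter Topology
open scoped ENNReal

namespace VectorMarket

/-- `ℝⁿ` with the Euclidean inner product, norm and Borel `σ`-algebra. -/
abbrev Vec (n : ℕ) : Type := EuclideanSpace ℝ (Fin n)

/-- The space `ℝ^{dT}` of paths of portfolio positions, as `T`-tuples of vectors of `ℝᵈ`.
Its norm is the maximum over `t` of the Euclidean norms of the components, which is equivalent to
the Euclidean norm of `ℝ^{dT}`; its `σ`-algebra is the product, hence Borel, `σ`-algebra. -/
abbrev Path (d T : ℕ) : Type := Fin T → Vec d

/-- The space `ℝⁿ ∪ {-∞}`; the adjoined point `-∞` is `⊥`. -/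
abbrev ExtVec (n : ℕ) : Type := WithBot (Vec n)

/-- The Borel `σ`-algebra of `ℝⁿ ∪ {-∞}`: a set is measurable if its part in `ℝⁿ` is Borel. -/
instance instMeasurableSpaceExtVec (n : ℕ) : MeasurableSpace (ExtVec n) :=
  MeasurableSpace.map (fun x : Vec n => (x : ExtVec n)) inferInstance

theorem measurableSet_extVec_iff {n : ℕ} {S : Set (ExtVec n)} :
    MeasurableSet S ↔ MeasurableSet {x : Vec n | (x : ExtVec n) ∈ S} :=
  Iff.rfl

/-- The scalar product `⟨z, y⟩` for `y ∈ ℝⁿ ∪ {-∞}`, with `⟨z, -∞⟩ = -∞` for every `z`. -/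
noncomputable def pairing {n : ℕ} (z : Vec n) : ExtVec n → EReal
  | ⊥ => ⊥
  | (y : Vec n) => ((inner ℝ z y : ℝ) : EReal)

/-- The preorder `a ⪰_K b` on `ℝⁿ ∪ {-∞}`: for vectors it means `a - b ∈ K`, and `-∞` is the
least element, below every vector and above none. -/
def Dominates {n : ℕ} (K : ProperCone ℝ (Vec n)) : ExtVec n → ExtVec n → Prop
  | _, ⊥ => True
  | ⊥, (_ : Vec n) => False
  | (a : Vec n), (b : Vec n) => a - b ∈ K

/-- The equivalence `a ∼_K b` that belongs to the preorder `⪰_K`. -/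
def ConeEquiv {n : ℕ} (K : ProperCone ℝ (Vec n)) (a b : ExtVec n) : Prop :=
  Dominates K a b ∧ Dominates K b a

/-- The positive polar cone `K° = {y | ⟨x, y⟩ ≥ 0 for all x ∈ K}`. -/
def posPolar {n : ℕ} (K : ProperCone ℝ (Vec n)) : Set (Vec n) :=
  {y | ∀ x ∈ K, 0 ≤ (inner ℝ x y : ℝ)}

/-- A measurable correspondence: the set of `ω` at which it meets a given open set is
measurable. -/
def MeasurableCorrespondence {Ω : Type*} [MeasurableSpace Ω] {n : ℕ} (C : Ω → Set (Vec n)) :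
    Prop :=
  ∀ U : Set (Vec n), IsOpen U → MeasurableSet {ω | (C ω ∩ U).Nonempty}

/-- A measurable selection of a correspondence. -/
def IsMeasurableSelection {Ω : Type*} [MeasurableSpace Ω] {n : ℕ} (C : Ω → Set (Vec n))
    (Z : Ω → Vec n) : Prop :=
  Measurable Z ∧ ∀ ω, Z ω ∈ C ω

section Strategies

variable {Ω : Type*} {mΩ : MeasurableSpace Ω} {T : ℕ}

/-- Strategies `(ϑ₀, …, ϑ_{T-1})`: the position `ϑ_t` is an `ℱ_t`-measurable random vector in
`ℝᵈ`. Strategies are measurable functions here; the passage to almost sure equivalence classes is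
made in `MarketModel`. -/
structure Strategy (ℱ : Filtration (Fin (T + 1)) mΩ) (d : ℕ) where
  /-- the path of positions -/
  toFun : Ω → Path d T
  adapted : ∀ t : Fin T, Measurable[ℱ t.castSucc] (fun ω => toFun ω t)

/-- The strategy `0`. -/
def Strategy.zero (ℱ : Filtration (Fin (T + 1)) mΩ) (d : ℕ) : Strategy ℱ d where
  toFun := fun _ => 0
  adapted := fun _ => measurable_const

open Classical in
/-- The strategy `(ϑ₀, …, ϑ_{t-1}, ϑ_t 1_A, ϑ_{t+1}, …, ϑ_{T-1})` for `A ∈ ℱ_t`. -/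
noncomputable def Strategy.localize {ℱ : Filtration (Fin (T + 1)) mΩ} {d : ℕ}
    (ϑ : Strategy ℱ d) (t : Fin T) (A : Set Ω) (hA : MeasurableSet[ℱ t.castSucc] A) :
    Strategy ℱ d where
  toFun := fun ω s => if s = t then A.indicator (fun ω' => ϑ.toFun ω' s) ω else ϑ.toFun ω s
  adapted := fun s => by
    by_cases h : s = t
    · subst h
      simpa using (ϑ.adapted s).indicator hA
    · simpa [h] using ϑ.adapted s

/-- A market model `V̂ : 𝒜 → L⁰(ℱ; ℝⁿ ∪ {-∞})`. Elements of `L⁰` are given by representatives: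
every value is a measurable function, and almost surely equal strategies have almost surely equal
values. -/
structure MarketModel (P : Measure Ω) (ℱ : Filtration (Fin (T + 1)) mΩ) (d n : ℕ) where
  /-- the outcome of trading -/
  toFun : Strategy ℱ d → Ω → ExtVec n
  measurable : ∀ ϑ, Measurable (toFun ϑ)
  congr_ae : ∀ ϑ ϑ' : Strategy ℱ d, ϑ.toFun =ᵐ[P] ϑ'.toFun → toFun ϑ =ᵐ[P] toFun ϑ'
  /-- normalization -/
  normalized : ∀ᵐ ω ∂P, toFun (Strategy.zero ℱ d) ω = ((0 : Vec n) : ExtVec n)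
  /-- locality: `V̂(ϑ) 1_A = V̂(ϑ₀, …, ϑ_t 1_A, …, ϑ_{T-1}) 1_A` almost surely -/
  locality : ∀ (t : Fin T) (A : Set Ω) (hA : MeasurableSet[ℱ t.castSucc] A) (ϑ : Strategy ℱ d),
    ∀ᵐ ω ∂P, ω ∈ A → toFun ϑ ω = toFun (ϑ.localize t A hA) ω

/-- Upper semicontinuity of an extended-real-valued map `W` on strategies: if essentially bounded
strategies `ϑ_k` converge in `L^∞` to the strategy `ϑ`, then `limsup_k W(ϑ_k) ≤ W(ϑ)` almost
surely. -/
def IsUpperSemicontinuous (P : Measure Ω) {ℱ : Filtration (Fin (T + 1)) mΩ} {d : ℕ}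
    (W : Strategy ℱ d → Ω → EReal) : Prop :=
  ∀ (ϑs : ℕ → Strategy ℱ d) (ϑ : Strategy ℱ d),
    (∀ k, MemLp (ϑs k).toFun ∞ P) →
    Tendsto (fun k => eLpNorm (fun ω => (ϑs k).toFun ω - ϑ.toFun ω) ∞ P) atTop (𝓝 0) →
    ∀ᵐ ω ∂P, limsup (fun k => W (ϑs k) ω) atTop ≤ W ϑ ω

/-- Upper semicontinuity of a market model with respect to the random cone `K`: for every
measurable selection `Z` of `ri K°` the scalarization `ϑ ↦ ⟨Z, V̂(ϑ)⟩` is upper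
semicontinuous. -/
def MarketModel.IsUpperSemicontinuous {P : Measure Ω} {ℱ : Filtration (Fin (T + 1)) mΩ}
    {d n : ℕ} (Vhat : MarketModel P ℱ d n) (K : Ω → ProperCone ℝ (Vec n)) : Prop :=
  ∀ Z : Ω → Vec n, IsMeasurableSelection (fun ω => intrinsicInterior ℝ (posPolar (K ω))) Z →
    VectorMarket.IsUpperSemicontinuous P (fun ϑ ω => pairing (Z ω) (Vhat.toFun ϑ ω))

end Strategies

end VectorMarket

/-! The proof scalarizes the model, represents each scalarization pointwise, and reassembles the
vector.

Scalar case (`IsUpperSemicontinuous.exists_measurable`): for a selection `Z` of `ri K°`, the map `W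
= ⟨Z, V̂⟩` is local and upper semicontinuous. With a suitable countable family of strategies `D m`,
put `V(ω, x) = inf_k sup {W (D m) ω : |D m ω - x| < 1/(k+1)}`. The family realizes the essential
suprema of `W` over the strategies near each point of a dense sequence, which gives `W ϑ ≤ V(·, ϑ)`.
The converse holds because finitely many members from each scale `k`, chosen by Borel–Cantelli, form
one sequence converging to `ϑ` in `L^∞`.

Vector case: measurable `w m` are dense in `K°`, and `Z` is a convergent positive combination of
them, so `Z` and all `Z + w m` lie in `ri K°` (`exists_measurableSelections`). Differences of scalar
representations give `⟨w m, V̂⟩`. These pairings determine, measurably, the projection of `V̂` to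
the span of `K°` (`vecOfPairings_eq`), and by the bipolar theorem the residual lies in `K ∩ -K`
(`sub_starProjection_mem`). The value `-∞` is read off from `⟨Z, V̂⟩` alone. -/

namespace VectorMarket

/-! ### Essential suprema of families of extended-real functions. -/

section EssentialSupremum

variable {Ω : Type*} {mΩ : MeasurableSpace Ω}

/-- A strictly monotone change of scale to values at most `1`, so that suprema can be compared
through finite integrals. -/
theorem strictAnti_inv_one_add_exp : StrictAnti (fun x : EReal => (1 + x.exp)⁻¹) :=
  fun _ _ h => ENNReal.inv_lt_inv.2
    (ENNReal.add_lt_add_left ENNReal.one_ne_top (EReal.exp_strictMono h))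

/-- The essential supremum of a family of measurable functions is the supremum of a sequence of
members of the family. -/
theorem exists_seq_ae_le_iSup (P : Measure Ω) [IsFiniteMeasure P] {ι : Type*} [Nonempty ι]
    (f : ι → Ω → EReal) (hf : ∀ i, Measurable (f i)) :
    ∃ s : ℕ → ι, ∀ i, ∀ᵐ ω ∂P, f i ω ≤ ⨆ k, f (s k) ω := by
  set φ : EReal → ℝ≥0∞ := fun x => (1 + x.exp)⁻¹ with hφ
  have hanti : StrictAnti φ := strictAnti_inv_one_add_exp
  have hφ1 : ∀ x, φ x ≤ 1 := fun x => ENNReal.inv_le_one.2 le_self_add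
  have hφm : Measurable φ := hanti.antitone.measurable
  set Φ : (ℕ → ι) → ℝ≥0∞ := fun s => ∫⁻ ω, φ (⨆ k, f (s k) ω) ∂P with hΦ
  have hfin : ∀ s, Φ s ≠ ∞ := fun s => by
    refine ((lintegral_mono fun ω => hφ1 _).trans_lt ?_).ne
    simp
  set m := ⨅ s, Φ s with hm
  have hmfin : m ≠ ∞ :=
    ((iInf_le Φ (fun _ => Classical.arbitrary ι)).trans_lt (hfin _).lt_top).ne
  have hex : ∀ n : ℕ, ∃ s, Φ s < m + (n : ℝ≥0∞)⁻¹ := fun n =>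
    iInf_lt_iff.1 (ENNReal.lt_add_right hmfin (by simp))
  choose S hS using hex
  -- Merging the minimizing sequences `S n` into one attains the infimum `m`.
  set s : ℕ → ι := fun j => S j.unpair.1 j.unpair.2 with hs
  have hsS : ∀ n ω, ⨆ k, f (S n k) ω ≤ ⨆ k, f (s k) ω := fun n ω => iSup_le fun k => by
    refine le_trans (le_of_eq ?_) (le_iSup (fun k => f (s k) ω) (Nat.pair n k))
    simp [hs]
  have hsm : Φ s ≤ m := by
    have ht : Tendsto (fun n : ℕ => m + (n : ℝ≥0∞)⁻¹) atTop (𝓝 (m + 0)) :=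
      tendsto_const_nhds.add ENNReal.tendsto_inv_nat_nhds_zero
    rw [add_zero] at ht
    exact ge_of_tendsto' ht fun n =>
      (lintegral_mono fun ω => hanti.antitone (hsS n ω)).trans (hS n).le
  refine ⟨s, fun i => ?_⟩
  -- Prepending `i` can only lower the integral, which is already minimal; hence the two suprema
  -- agree almost everywhere.
  set s' : ℕ → ι := fun j => Nat.casesOn j i s with hs'
  have hle : ∀ ω, ⨆ k, f (s k) ω ≤ ⨆ k, f (s' k) ω := fun ω => iSup_le fun k =>
    le_iSup (fun k => f (s' k) ω) (k + 1)
  have hmeas : ∀ u : ℕ → ι, Measurable fun ω => φ (⨆ k, f (u k) ω) := fun u =>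
    hφm.comp (Measurable.iSup fun k => hf _)
  have hae := ae_eq_of_ae_le_of_lintegral_le (μ := P)
    (f := fun ω => φ (⨆ k, f (s' k) ω)) (g := fun ω => φ (⨆ k, f (s k) ω))
    (Eventually.of_forall fun ω => hanti.antitone (hle ω)) (hfin s') (hmeas s).aemeasurable
    (hsm.trans (iInf_le Φ s'))
  filter_upwards [hae] with ω hω
  rw [← hanti.injective hω]
  exact le_iSup (fun k => f (s' k) ω) 0

end EssentialSupremum

/-! ### Representation of scalar local upper semicontinuous maps. -/

section Scalar

variable {Ω : Type*} {mΩ : MeasurableSpace Ω} {T : ℕ} {ℱ : Filtration (Fin (T + 1)) mΩ} {d : ℕ}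

@[ext]
theorem Strategy.ext {ϑ ϑ' : Strategy ℱ d} (h : ϑ.toFun = ϑ'.toFun) : ϑ = ϑ' := by
  cases ϑ; cases ϑ'; cases h; rfl

theorem Strategy.measurable (ϑ : Strategy ℱ d) : Measurable ϑ.toFun :=
  measurable_pi_lambda _ fun t => (ϑ.adapted t).mono (ℱ.le _) le_rfl

/-- The strategy with constant positions `x`. -/
def Strategy.const (ℱ : Filtration (Fin (T + 1)) mΩ) (x : Path d T) : Strategy ℱ d where
  toFun := fun _ => x
  adapted := fun _ => measurable_const

open Classical in
/-- The strategy which follows `η` at those times at which its position has distance less than `r`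
from that of `ϑ`, and `ϑ` at the other times. -/
noncomputable def Strategy.near (r : ℝ) (η ϑ : Strategy ℱ d) : Strategy ℱ d where
  toFun := fun ω t =>
    -- The test is made separately at each time, since a condition on the whole path would not be
    -- adapted.
    if ‖η.toFun ω t - ϑ.toFun ω t‖ < r then η.toFun ω t else ϑ.toFun ω t
  adapted := fun t => Measurable.ite
    ((measurable_norm.comp (measurable_sub.comp ((η.adapted t).prodMk (ϑ.adapted t))))
      (measurableSet_Iio : MeasurableSet (Set.Iio r)))
    (η.adapted t) (ϑ.adapted t)

theorem Strategy.near_sub_lt {r : ℝ} (hr : 0 < r) (η ϑ : Strategy ℱ d) (ω : Ω) :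
    ‖(η.near r ϑ).toFun ω - ϑ.toFun ω‖ < r := by
  rw [pi_norm_lt_iff hr]
  intro t
  simp only [Strategy.near, Pi.sub_apply]
  split_ifs with h
  · exact h
  · simpa using hr

theorem Strategy.near_eq {r : ℝ} (hr : 0 < r) {η ϑ : Strategy ℱ d} {ω : Ω}
    (h : ‖η.toFun ω - ϑ.toFun ω‖ < r) : (η.near r ϑ).toFun ω = η.toFun ω := by
  rw [pi_norm_lt_iff hr] at h
  funext t
  simp only [Strategy.near]
  exact if_pos (h t)

/-- A map `W` on strategies is local if strategies that coincide at `ω` have the same value at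
`ω`, for almost every `ω`. -/
def IsLocal (P : Measure Ω) {α : Type*} (W : Strategy ℱ d → Ω → α) : Prop :=
  ∀ ϑ ϑ' : Strategy ℱ d, ∀ᵐ ω ∂P, ϑ.toFun ω = ϑ'.toFun ω → W ϑ ω = W ϑ' ω

theorem Strategy.memLp_top (P : Measure Ω) (ϑ : Strategy ℱ d) (C : ℝ)
    (h : ∀ ω, ‖ϑ.toFun ω‖ ≤ C) : MemLp ϑ.toFun ∞ P :=
  memLp_top_of_bound ϑ.measurable.aestronglyMeasurable C (Eventually.of_forall h)

/-- If `W` is upper semicontinuous, then the essential suprema of `W` over countable families of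
strategies that shrink to `ϑ` do not exceed `W ϑ` in the limit. -/
theorem IsUpperSemicontinuous.iInf_iSup_le {P : Measure Ω} [IsFiniteMeasure P]
    {W : Strategy ℱ d → Ω → EReal} (hW : IsUpperSemicontinuous P W)
    (hmeas : ∀ ϑ, Measurable (W ϑ)) {ϑ : Strategy ℱ d} {C : ℝ} (hC : ∀ ω, ‖ϑ.toFun ω‖ ≤ C)
    (η : ℕ → ℕ → Strategy ℱ d)
    (hη : ∀ k j ω, ‖(η k j).toFun ω - ϑ.toFun ω‖ ≤ 1 / ((k : ℝ) + 1)) :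
    ∀ᵐ ω ∂P, ⨅ k, ⨆ j, W (η k j) ω ≤ W ϑ ω := by
  classical
  suffices H : ∀ q : ℚ, ∀ᵐ ω ∂P, (((q : ℝ) : EReal) < ⨅ k, ⨆ j, W (η k j) ω) →
      ((q : ℝ) : EReal) ≤ W ϑ ω by
    filter_upwards [ae_all_iff.2 H] with ω hω
    by_contra! hlt
    obtain ⟨q, hq1, hq2⟩ := EReal.lt_iff_exists_rat_btwn.1 hlt
    exact absurd (hω q hq2) (not_le.2 hq1)
  intro q
  set c : EReal := ((q : ℝ) : EReal) with hc
  -- At scale `k` the level is exceeded, but by none of the first `J` members. These sets decrease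
  -- to `∅` as `J` grows.
  set A : ℕ → ℕ → Set Ω := fun k J => {ω | ∃ j, c < W (η k j) ω} \ {ω | ∃ j < J, c < W (η k j) ω}
    with hA
  have hm : ∀ k j, MeasurableSet {ω | c < W (η k j) ω} := fun k j =>
    measurableSet_lt measurable_const (hmeas _)
  have hAm : ∀ k J, MeasurableSet (A k J) := fun k J => by
    refine MeasurableSet.diff ?_ ?_
    · simpa only [Set.ofPred_exists] using MeasurableSet.iUnion fun j => hm k j
    · have : {ω | ∃ j < J, c < W (η k j) ω} = ⋃ j, ⋃ _ : j < J, {ω | c < W (η k j) ω} := by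
        ext ω; simp
      rw [this]
      exact MeasurableSet.iUnion fun j => MeasurableSet.iUnion fun _ => hm k j
  have hex : ∀ k, ∃ J, P (A k J) < (2⁻¹ : ℝ≥0∞) ^ k := fun k => by
    have ht : Tendsto (fun J => P (A k J)) atTop (𝓝 (P (⋂ J, A k J))) := by
      refine tendsto_measure_iInter_atTop (fun J => (hAm k J).nullMeasurableSet) ?_
        ⟨0, measure_ne_top _ _⟩
      rintro J J' hJ ω ⟨h1, h2⟩
      exact ⟨h1, fun ⟨j, hj, h⟩ => h2 ⟨j, hj.trans_le hJ, h⟩⟩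
    have h0 : ⋂ J, A k J = ∅ := by
      ext ω
      simp only [Set.mem_iInter, Set.mem_empty_iff_false, iff_false, not_forall]
      by_cases h : ∃ j, c < W (η k j) ω
      · obtain ⟨j, hj⟩ := h
        exact ⟨j + 1, fun h => h.2 ⟨j, j.lt_succ_self, hj⟩⟩
      · exact ⟨0, fun h' => h h'.1⟩
    rw [h0, measure_empty] at ht
    exact (ht.eventually (gt_mem_nhds (ENNReal.pow_pos (by simp) k))).exists
  choose J hJ using hex
  have hbc : ∀ᵐ ω ∂P, ∀ᶠ k in atTop, ω ∉ A k (J k) := by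
    refine ae_eventually_notMem ?_
    refine ((ENNReal.tsum_le_tsum fun k => (hJ k).le).trans_lt ?_).ne
    rw [ENNReal.tsum_geometric]
    simp
  -- An enumeration of the finite blocks `j < J k`, padded with `ϑ`. Only finitely many terms come
  -- from scales below a given `k₀`, whence convergence in `L^∞`.
  set ζ : ℕ → Strategy ℱ d := fun m =>
    if m.unpair.2 < J m.unpair.1 then η m.unpair.1 m.unpair.2 else ϑ with hζ
  have hζle : ∀ m ω, ‖(ζ m).toFun ω - ϑ.toFun ω‖ ≤ 1 := fun m ω => by
    simp only [hζ]
    split_ifs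
    · refine (hη _ _ _).trans ?_
      rw [div_le_one (by positivity)]
      linarith [(Nat.cast_nonneg m.unpair.1 : (0 : ℝ) ≤ _)]
    · simp
  have hζtend : Tendsto (fun m => eLpNorm (fun ω => (ζ m).toFun ω - ϑ.toFun ω) ∞ P) atTop
      (𝓝 0) := by
    rw [ENNReal.tendsto_nhds_zero]
    intro ε hε
    obtain ⟨k₀, hk₀⟩ : ∃ k₀ : ℕ, ENNReal.ofReal (1 / ((k₀ : ℝ) + 1)) < ε := by
      have ht := ENNReal.tendsto_ofReal (tendsto_one_div_add_atTop_nhds_zero_nat (𝕜 := ℝ))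
      rw [ENNReal.ofReal_zero] at ht
      exact (ht.eventually (gt_mem_nhds hε)).exists
    set F : Finset ℕ :=
      (Finset.range k₀).biUnion fun k => (Finset.range (J k)).image fun j => Nat.pair k j
    have hF : ∀ᶠ m in atTop, m ∉ F := by
      rw [← Nat.cofinite_eq_atTop]
      exact F.finite_toSet.eventually_cofinite_notMem
    filter_upwards [hF] with m hmF
    have hb : ∀ ω, ‖(ζ m).toFun ω - ϑ.toFun ω‖ ≤ 1 / ((k₀ : ℝ) + 1) := fun ω => by
      simp only [hζ]
      split_ifs with h
      · have hk : k₀ ≤ m.unpair.1 := by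
          by_contra! hlt
          refine hmF (Finset.mem_biUnion.2 ⟨m.unpair.1, Finset.mem_range.2 hlt,
            Finset.mem_image.2 ⟨m.unpair.2, Finset.mem_range.2 h, Nat.pair_unpair m⟩⟩)
        refine (hη _ _ _).trans ?_
        have : (k₀ : ℝ) ≤ m.unpair.1 := by exact_mod_cast hk
        gcongr
      · simp only [sub_self, norm_zero]
        positivity
    rw [eLpNorm_exponent_top]
    exact (eLpNormEssSup_le_of_ae_bound (Eventually.of_forall hb)).trans hk₀.le
  have hmem : ∀ m, MemLp (ζ m).toFun ∞ P := fun m =>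
    (ζ m).memLp_top P (1 + C) fun ω => by
      have h := norm_add_le ((ζ m).toFun ω - ϑ.toFun ω) (ϑ.toFun ω)
      rw [sub_add_cancel] at h
      exact h.trans (add_le_add (hζle m ω) (hC ω))
  filter_upwards [hbc, hW ζ ϑ hmem hζtend] with ω hω hlim hlt
  refine le_trans ?_ hlim
  refine le_limsup_of_frequently_le ?_
  rw [frequently_atTop]
  intro N
  obtain ⟨k, hk, hkN⟩ := (hω.and (eventually_ge_atTop N)).exists
  have h1 : ∃ j, c < W (η k j) ω := lt_iSup_iff.1 (hlt.trans_le (iInf_le _ k))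
  have h2 : ∃ j < J k, c < W (η k j) ω := by
    by_contra h
    exact hk ⟨h1, h⟩
  obtain ⟨j, hj, hcj⟩ := h2
  refine ⟨Nat.pair k j, hkN.trans (Nat.left_le_pair k j), ?_⟩
  simpa [hζ, hj] using hcj.le

/-- A local and upper semicontinuous map on strategies is given by evaluation of a measurable
function at the positions. -/
theorem IsUpperSemicontinuous.exists_measurable {P : Measure Ω} [IsFiniteMeasure P]
    {W : Strategy ℱ d → Ω → EReal} (hW : IsUpperSemicontinuous P W) (hloc : IsLocal P W)
    (hmeas : ∀ ϑ, Measurable (W ϑ)) :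
    ∃ V : Ω × Path d T → EReal, Measurable V ∧
      ∀ ϑ : Strategy ℱ d, ∀ᵐ ω ∂P, V (ω, ϑ.toFun ω) = W ϑ ω := by
  classical
  set r : ℕ → ℝ := fun k => 1 / ((k : ℝ) + 1) with hr
  have hr0 : ∀ k, 0 < r k := fun k => by positivity
  set x : ℕ → Path d T := TopologicalSpace.denseSeq (Path d T)
  have hball : ∀ k i, ∃ s : ℕ → {η : Strategy ℱ d // ∀ ω, ‖η.toFun ω - x i‖ < r k / 2},
      -- Radius `r k / 2` around `x i` leaves room for the triangle inequality when `ϑ ω` is itself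
      -- within `r k / 2` of `x i`.
      ∀ η : {η : Strategy ℱ d // ∀ ω, ‖η.toFun ω - x i‖ < r k / 2},
        ∀ᵐ ω ∂P, W η ω ≤ ⨆ j, W (s j) ω := fun k i => by
    have : Nonempty {η : Strategy ℱ d // ∀ ω, ‖η.toFun ω - x i‖ < r k / 2} :=
      ⟨⟨Strategy.const ℱ (x i), fun ω => by
        simpa [Strategy.const] using hr0 k⟩⟩
    exact exists_seq_ae_le_iSup P _ fun η => hmeas _
  choose s hs using hball
  obtain ⟨e⟩ : Nonempty (ℕ ≃ ℕ × ℕ × ℕ) := ⟨(Denumerable.eqv (ℕ × ℕ × ℕ)).symm⟩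
  set D : ℕ → Strategy ℱ d := fun m => (s (e m).1 (e m).2.1 (e m).2.2 : Strategy ℱ d) with hD
  set V : Ω × Path d T → EReal := fun p =>
    ⨅ k, ⨆ m, if ‖(D m).toFun p.1 - p.2‖ < r k then W (D m) p.1 else ⊥ with hV
  have hVm : Measurable V := by
    refine Measurable.iInf fun k => Measurable.iSup fun m => Measurable.ite ?_
      ((hmeas _).comp measurable_fst) measurable_const
    exact measurableSet_lt (((D m).measurable.comp measurable_fst).sub measurable_snd).norm
      measurable_const
  -- Moving `ϑ` into the ball around `x i` changes nothing at those `ω` where it is already there,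
  -- so locality transfers the bound.
  have hlower : ∀ ϑ : Strategy ℱ d, ∀ᵐ ω ∂P, W ϑ ω ≤ V (ω, ϑ.toFun ω) := fun ϑ => by
    have h1 : ∀ᵐ ω ∂P, ∀ k i, ϑ.toFun ω = (ϑ.near (r k / 2) (Strategy.const ℱ (x i))).toFun ω →
        W ϑ ω = W (ϑ.near (r k / 2) (Strategy.const ℱ (x i))) ω :=
      ae_all_iff.2 fun k => ae_all_iff.2 fun i => hloc _ _
    have h2 : ∀ᵐ ω ∂P, ∀ k i, W (ϑ.near (r k / 2) (Strategy.const ℱ (x i))) ω ≤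
        ⨆ j, W (s k i j) ω :=
      ae_all_iff.2 fun k => ae_all_iff.2 fun i => hs k i
        ⟨ϑ.near (r k / 2) (Strategy.const ℱ (x i)), fun ω =>
          Strategy.near_sub_lt (half_pos (hr0 k)) ϑ (Strategy.const ℱ (x i)) ω⟩
    filter_upwards [h1, h2] with ω hω1 hω2
    refine le_iInf fun k => ?_
    obtain ⟨i, hi⟩ := (TopologicalSpace.denseRange_denseSeq (Path d T)).exists_dist_lt (ϑ.toFun ω)
      (half_pos (hr0 k))
    rw [dist_eq_norm] at hi
    have heq := Strategy.near_eq (ϑ := Strategy.const ℱ (x i)) (half_pos (hr0 k)) hi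
    rw [hω1 k i heq.symm]
    refine (hω2 k i).trans (iSup_le fun j => ?_)
    obtain ⟨m, hm⟩ := e.surjective (k, i, j)
    have hDm : D m = s k i j := by
      simp only [hD]
      rw [hm]
    refine le_iSup_of_le m ?_
    have hlt : ‖(D m).toFun ω - ϑ.toFun ω‖ < r k := by
      rw [hDm]
      have h := norm_sub_le_norm_sub_add_norm_sub ((s k i j : Strategy ℱ d).toFun ω) (x i)
        (ϑ.toFun ω)
      have h' := (s k i j).2 ω
      rw [norm_sub_rev (x i)] at h
      have : ‖ϑ.toFun ω - x i‖ < r k / 2 := hi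
      linarith
    rw [if_pos hlt, hDm]
  have hupper : ∀ (ϑ : Strategy ℱ d) (C : ℝ), (∀ ω, ‖ϑ.toFun ω‖ ≤ C) →
      ∀ᵐ ω ∂P, V (ω, ϑ.toFun ω) ≤ W ϑ ω := fun ϑ C hC => by
    have h1 := hW.iInf_iSup_le hmeas hC (fun k m => (D m).near (r k) ϑ)
      fun k m ω => (Strategy.near_sub_lt (hr0 k) _ _ ω).le
    have h2 : ∀ᵐ ω ∂P, ∀ k m, ((D m).near (r k) ϑ).toFun ω = (D m).toFun ω →
        W ((D m).near (r k) ϑ) ω = W (D m) ω :=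
      ae_all_iff.2 fun k => ae_all_iff.2 fun m => hloc _ _
    filter_upwards [h1, h2] with ω hω1 hω2
    refine le_trans (iInf_mono fun k => iSup_mono fun m => ?_) hω1
    split_ifs with h
    · exact (hω2 k m (Strategy.near_eq (hr0 k) h)).ge
    · exact bot_le
  refine ⟨V, hVm, fun ϑ => ?_⟩
  -- Bounded truncations, to which `hupper` applies; each `ω` is untouched for large `N`.
  set ψ : ℕ → Strategy ℱ d := fun N => ϑ.near ((N : ℝ) + 1) (Strategy.zero ℱ d) with hψ
  have hpos : ∀ N : ℕ, (0 : ℝ) < (N : ℝ) + 1 := fun N => by positivity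
  have h1 : ∀ᵐ ω ∂P, ∀ N, V (ω, (ψ N).toFun ω) ≤ W (ψ N) ω := ae_all_iff.2 fun N =>
    hupper (ψ N) ((N : ℝ) + 1) fun ω => by
      have h := (Strategy.near_sub_lt (hpos N) ϑ (Strategy.zero ℱ d) ω).le
      rwa [show (Strategy.zero ℱ d).toFun ω = 0 from rfl, sub_zero] at h
  have h2 : ∀ᵐ ω ∂P, ∀ N, (ψ N).toFun ω = ϑ.toFun ω → W (ψ N) ω = W ϑ ω :=
    ae_all_iff.2 fun N => hloc _ _
  filter_upwards [hlower ϑ, h1, h2] with ω hω hω1 hω2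
  refine le_antisymm ?_ hω
  obtain ⟨N, hN⟩ := exists_nat_gt ‖ϑ.toFun ω‖
  have heq : (ψ N).toFun ω = ϑ.toFun ω := Strategy.near_eq (hpos N) (by
    simp only [Strategy.zero, sub_zero]
    linarith)
  have h := hω1 N
  rwa [heq, hω2 N heq] at h

end Scalar

end VectorMarket

namespace VectorMarket

/-! ### Projections onto closed convex cones and their measurability. -/

section Cone

open scoped InnerProductSpace

variable {E : Type*} [NormedAddCommGroup E] [InnerProductSpace ℝ E]

section Projection

variable [CompleteSpace E]

theorem exists_mem_forall_inner_sub_le (K : ProperCone ℝ E) (x : E) :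
    ∃ v ∈ K, ∀ w ∈ K, ⟪x - v, w - v⟫_ℝ ≤ 0 := by
  have hconv : Convex ℝ (K : Set E) := (K : PointedCone ℝ E).toConvexCone.convex
  obtain ⟨v, hv, h⟩ := exists_norm_eq_iInf_of_complete_convex (K := (K : Set E))
    ⟨0, K.zero_mem⟩ K.isClosed.isComplete hconv x
  exact ⟨v, hv, (norm_eq_iInf_iff_real_inner_le_zero hconv hv).1 h⟩

/-- The metric projection onto a closed convex cone. -/
noncomputable def coneProj (K : ProperCone ℝ E) (x : E) : E :=
  (exists_mem_forall_inner_sub_le K x).choose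

variable (K : ProperCone ℝ E) (x y : E)

theorem coneProj_mem : coneProj K x ∈ K :=
  (exists_mem_forall_inner_sub_le K x).choose_spec.1

theorem inner_sub_coneProj_le {w : E} (hw : w ∈ K) :
    ⟪x - coneProj K x, w - coneProj K x⟫_ℝ ≤ 0 :=
  (exists_mem_forall_inner_sub_le K x).choose_spec.2 w hw

theorem norm_sub_coneProj_le {w : E} (hw : w ∈ K) : ‖x - coneProj K x‖ ≤ ‖x - w‖ := by
  have h := inner_sub_coneProj_le K x hw
  have h2 : ‖x - w‖ ^ 2 = ‖x - coneProj K x‖ ^ 2 - 2 * ⟪x - coneProj K x, w - coneProj K x⟫_ℝ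
      + ‖w - coneProj K x‖ ^ 2 := by
    rw [← norm_sub_sq_real, sub_sub_sub_cancel_right]
  refine le_of_sq_le_sq ?_ (norm_nonneg _)
  nlinarith [sq_nonneg ‖w - coneProj K x‖]

theorem infDist_eq_norm_sub_coneProj : Metric.infDist x (K : Set E) = ‖x - coneProj K x‖ := by
  refine le_antisymm ?_ ?_
  · rw [← dist_eq_norm]
    exact Metric.infDist_le_dist_of_mem (coneProj_mem K x)
  · refine (Metric.le_infDist (⟨0, K.zero_mem⟩ : (K : Set E).Nonempty)).2 fun {w} hw => ?_
    rw [dist_eq_norm]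
    exact norm_sub_coneProj_le K x hw

theorem norm_coneProj_sub_le : ‖coneProj K x - coneProj K y‖ ≤ ‖x - y‖ := by
  have h1 := inner_sub_coneProj_le K x (coneProj_mem K y)
  have h2 := inner_sub_coneProj_le K y (coneProj_mem K x)
  have h3 : ‖coneProj K x - coneProj K y‖ ^ 2 ≤ ⟪x - y, coneProj K x - coneProj K y⟫_ℝ := by
    rw [← real_inner_self_eq_norm_sq]
    simp only [inner_sub_left, inner_sub_right] at *
    linarith [real_inner_comm (coneProj K x) (coneProj K y)]
  have h4 := real_inner_le_norm (x - y) (coneProj K x - coneProj K y)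
  by_contra! h
  have h5 := norm_nonneg (x - y)
  nlinarith

/-- The directional difference quotients of half the squared distance to a closed convex cone
converge to the components of the residual of the projection. -/
theorem abs_sq_infDist_sub_le (h : E) :
    |(Metric.infDist (x + h) (K : Set E) ^ 2 - Metric.infDist x (K : Set E) ^ 2) -
      2 * ⟪h, x - coneProj K x⟫_ℝ| ≤ ‖h‖ ^ 2 := by
  rw [infDist_eq_norm_sub_coneProj, infDist_eq_norm_sub_coneProj, abs_le]
  -- Each projection is a competitor for the other point, giving bounds from both sides;
  -- nonexpansiveness controls the error.
  have h1 := norm_sub_coneProj_le K (x + h) (coneProj_mem K x)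
  have h2 := norm_sub_coneProj_le K x (coneProj_mem K (x + h))
  have h3 := norm_coneProj_sub_le K (x + h) x
  rw [add_sub_cancel_left] at h3
  have h4 := real_inner_le_norm h (coneProj K (x + h) - coneProj K x)
  have h5 : ⟪h, coneProj K (x + h) - coneProj K x⟫_ℝ ≤ ‖h‖ ^ 2 := by
    refine h4.trans ?_
    rw [sq]
    gcongr
  have e1 : ‖x + h - coneProj K x‖ ^ 2 =
      ‖x - coneProj K x‖ ^ 2 + 2 * ⟪h, x - coneProj K x⟫_ℝ + ‖h‖ ^ 2 := by
    rw [show x + h - coneProj K x = (x - coneProj K x) + h by abel, norm_add_sq_real,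
      real_inner_comm]
  have e2 : ‖x - coneProj K (x + h)‖ ^ 2 = ‖x + h - coneProj K (x + h)‖ ^ 2
      - 2 * ⟪h, x + h - coneProj K (x + h)⟫_ℝ + ‖h‖ ^ 2 := by
    rw [show x - coneProj K (x + h) = (x + h - coneProj K (x + h)) - h by abel, norm_sub_sq_real,
      real_inner_comm]
  have e3 : ⟪h, x + h - coneProj K (x + h)⟫_ℝ = ⟪h, x - coneProj K x⟫_ℝ + ‖h‖ ^ 2
      - ⟪h, coneProj K (x + h) - coneProj K x⟫_ℝ := by
    rw [← real_inner_self_eq_norm_sq h, ← inner_add_right, ← inner_sub_right]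
    congr 1
    abel
  have h1' := pow_le_pow_left₀ (norm_nonneg _) h1 2
  have h2' := pow_le_pow_left₀ (norm_nonneg _) h2 2
  constructor <;> linarith

/-- The metric projection onto the polar cone `{y | ⟪k, y⟫ ≥ 0 for all k ∈ K}`. -/
noncomputable def dualProj (K : ProperCone ℝ E) (x : E) : E := x + coneProj K (-x)

theorem dualProj_mem : dualProj K x ∈ ProperCone.innerDual (K : Set E) := by
  rw [ProperCone.mem_innerDual]
  intro k hk
  have h := inner_sub_coneProj_le K (-x) (add_mem (coneProj_mem K (-x)) hk)
  rw [add_sub_cancel_left, real_inner_comm, ← neg_add', inner_neg_right] at h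
  simpa [dualProj] using h

theorem dualProj_eq_self {x : E} (hx : x ∈ ProperCone.innerDual (K : Set E)) :
    dualProj K x = x := by
  have h1 := ProperCone.mem_innerDual.1 hx (coneProj_mem K (-x))
  have h2 := inner_sub_coneProj_le K (-x) K.zero_mem
  rw [zero_sub, inner_neg_right, ← neg_add', inner_neg_left, neg_neg, inner_add_left,
    real_inner_self_eq_norm_sq, real_inner_comm] at h2
  have h3 : ‖coneProj K (-x)‖ = 0 := by
    have := sq_nonneg ‖coneProj K (-x)‖
    exact pow_eq_zero_iff two_ne_zero |>.1 (by linarith)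
  rw [dualProj, norm_eq_zero.1 h3, add_zero]

theorem norm_dualProj_sub_le : ‖dualProj K x - dualProj K y‖ ≤ 2 * ‖x - y‖ := by
  have h := norm_coneProj_sub_le K (-x) (-y)
  rw [neg_sub_neg, norm_sub_rev y x] at h
  have h' := norm_add_le (x - y) (coneProj K (-x) - coneProj K (-y))
  rw [dualProj, dualProj, add_sub_add_comm]
  linarith

theorem norm_dualProj_le : ‖dualProj K x‖ ≤ 2 * ‖x‖ := by
  have h := norm_dualProj_sub_le K x 0
  rwa [dualProj_eq_self K (zero_mem _), sub_zero, sub_zero] at h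

/-- A Lipschitz map that fixes the polar cone carries a dense sequence of `E` to a dense sequence of
the cone. -/
theorem innerDual_subset_closure_range_dualProj {q : ℕ → E} (hq : DenseRange q) :
    (ProperCone.innerDual (K : Set E) : Set E) ⊆
      closure (Set.range fun m => dualProj K (q m)) := by
  intro u hu
  rw [Metric.mem_closure_range_iff]
  intro ε hε
  obtain ⟨m, hm⟩ := hq.exists_dist_lt u (half_pos hε)
  refine ⟨m, ?_⟩
  have h := norm_dualProj_sub_le K u (q m)
  rw [dualProj_eq_self K hu] at h
  rw [dist_eq_norm] at hm ⊢
  linarith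

end Projection

section Measurability

variable [FiniteDimensional ℝ E] [MeasurableSpace E] [BorelSpace E]
  {Ω : Type*} [MeasurableSpace Ω] {K : Ω → ProperCone ℝ E}

/-- Sublevel sets of the distance to `K ω` are hitting events of open balls; difference quotients of
its square then converge to the coordinates of the residual. -/
theorem measurable_coneProj [CompleteSpace E]
    (hK : ∀ U : Set E, IsOpen U → MeasurableSet {ω | ((K ω : Set E) ∩ U).Nonempty}) (x : E) :
    Measurable fun ω => coneProj (K ω) x := by
  have hdist : ∀ y, Measurable fun ω => Metric.infDist y (K ω : Set E) := fun y => by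
    refine measurable_of_Iio fun r => ?_
    have : (fun ω => Metric.infDist y (K ω : Set E)) ⁻¹' Set.Iio r =
        {ω | ((K ω : Set E) ∩ Metric.ball y r).Nonempty} := by
      ext ω
      simp only [Set.mem_preimage, Set.mem_Iio, Set.mem_ofPred_eq,
        Metric.infDist_lt_iff (⟨0, (K ω).zero_mem⟩ : (K ω : Set E).Nonempty)]
      exact ⟨fun ⟨z, hz, h⟩ => ⟨z, hz, by rwa [Metric.mem_ball, dist_comm]⟩,
        fun ⟨z, hz, h⟩ => ⟨z, hz, by rwa [Metric.mem_ball, dist_comm] at h⟩⟩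
    rw [this]
    exact hK _ Metric.isOpen_ball
  have hinner : ∀ e : E, Measurable fun ω => ⟪e, x - coneProj (K ω) x⟫_ℝ := fun e => by
    refine measurable_of_tendsto_metrizable (f := fun (k : ℕ) ω => ((k : ℝ) + 1) / 2 *
      (Metric.infDist (x + (1 / ((k : ℝ) + 1)) • e) (K ω : Set E) ^ 2 -
        Metric.infDist x (K ω : Set E) ^ 2))
      (fun k => (((hdist _).pow_const 2).sub ((hdist _).pow_const 2)).const_mul _) ?_
    rw [tendsto_pi_nhds]
    intro ω
    rw [tendsto_iff_norm_sub_tendsto_zero]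
    have ht := (tendsto_one_div_add_atTop_nhds_zero_nat (𝕜 := ℝ)).mul_const (‖e‖ ^ 2 / 2)
    rw [zero_mul] at ht
    refine squeeze_zero (fun _ => norm_nonneg _) (fun k => ?_) ht
    have hk : (0 : ℝ) < (k : ℝ) + 1 := by positivity
    have h := abs_sq_infDist_sub_le (K ω) x ((1 / ((k : ℝ) + 1)) • e)
    rw [norm_smul, real_inner_smul_left, Real.norm_of_nonneg (by positivity)] at h
    set a := Metric.infDist (x + (1 / ((k : ℝ) + 1)) • e) (K ω : Set E) ^ 2 -
        Metric.infDist x (K ω : Set E) ^ 2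
    have e1 : ((k : ℝ) + 1) / 2 * a - ⟪e, x - coneProj (K ω) x⟫_ℝ = ((k : ℝ) + 1) / 2 *
        (a - 2 * (1 / ((k : ℝ) + 1) * ⟪e, x - coneProj (K ω) x⟫_ℝ)) := by
      field_simp
    rw [e1, norm_mul, Real.norm_of_nonneg (by positivity), Real.norm_eq_abs]
    refine (mul_le_mul_of_nonneg_left h (by positivity)).trans (le_of_eq ?_)
    field_simp
  have hrepr : (fun ω => coneProj (K ω) x) = fun ω => x - ∑ i,
      ⟪stdOrthonormalBasis ℝ E i, x - coneProj (K ω) x⟫_ℝ • stdOrthonormalBasis ℝ E i := by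
    funext ω
    rw [(stdOrthonormalBasis ℝ E).sum_repr', sub_sub_cancel]
  rw [hrepr]
  exact measurable_const.sub (Finset.measurable_sum _ fun i _ => (hinner _).smul_const _)

theorem measurable_dualProj [CompleteSpace E]
    (hK : ∀ U : Set E, IsOpen U → MeasurableSet {ω | ((K ω : Set E) ∩ U).Nonempty}) (x : E) :
    Measurable fun ω => dualProj (K ω) x :=
  measurable_const.add (measurable_coneProj hK (-x))

end Measurability

/-! ### Relative interior points of a closed convex cone. -/

section RelativeInterior

/-- Replaces the affine span by the linear span, where open sets arise as images under linear maps.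
-/
theorem mem_intrinsicInterior_of_isOpen {s : Set E} {z : E} (hz : z ∈ s)
    {O : Set (Submodule.span ℝ s)} (hO : IsOpen O) (hzO : ⟨z, Submodule.subset_span hz⟩ ∈ O)
    (hsub : ∀ y ∈ O, (y : E) ∈ s) : z ∈ intrinsicInterior ℝ s := by
  have hspan : ∀ y : affineSpan ℝ s, (y : E) ∈ Submodule.span ℝ s := fun y =>
    affineSpan_subset_span y.2
  rw [mem_intrinsicInterior]
  refine ⟨⟨z, subset_affineSpan ℝ s hz⟩, ?_, rfl⟩
  rw [mem_interior]
  refine ⟨(fun y : affineSpan ℝ s => (⟨y, hspan y⟩ : Submodule.span ℝ s)) ⁻¹' O,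
    fun y hy => hsub _ hy, hO.preimage (by fun_prop), hzO⟩

theorem tsum_mem_properCone (C : ProperCone ℝ E) {f : ℕ → E} (hf : ∀ m, f m ∈ C)
    (hs : Summable f) : ∑' m, f m ∈ C :=
  C.isClosed.mem_of_tendsto hs.hasSum.tendsto_sum_nat
    (Eventually.of_forall fun _ => sum_mem fun m _ => hf m)

/-- A convergent combination with positive coefficients of a dense sequence in a closed convex
cone belongs to the relative interior of the cone. -/
theorem tsum_add_mem_intrinsicInterior [FiniteDimensional ℝ E] (C : ProperCone ℝ E) {w : ℕ → E} (hw : ∀ m, w m ∈ C)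
    (hdense : (C : Set E) ⊆ closure (Set.range w)) {c : ℕ → ℝ} (hc : ∀ m, 0 < c m)
    (hs : Summable fun m => c m • w m) {v : E} (hv : v ∈ C) :
    (∑' m, c m • w m) + v ∈ intrinsicInterior ℝ (C : Set E) := by
  set S := Submodule.span ℝ (C : Set E) with hS
  set w' : ℕ → S := fun m => ⟨w m, Submodule.subset_span (hw m)⟩ with hw'
  let f : ℕ →o Submodule ℝ S :=
    ⟨fun N => Submodule.span ℝ (w' '' Set.Iio N), fun _ _ h =>
      Submodule.span_mono (Set.image_mono (Set.Iio_subset_Iio h))⟩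
  obtain ⟨N, hN⟩ := monotone_stabilizes_iff_noetherian.2 (inferInstance : IsNoetherian ℝ S) f
  have hmemN : ∀ m, w' m ∈ f N := fun m => by
    rcases le_total N (m + 1) with h | h
    · rw [hN _ h]
      exact Submodule.subset_span ⟨m, m.lt_succ_self, rfl⟩
    · exact f.monotone h (Submodule.subset_span ⟨m, m.lt_succ_self, rfl⟩)
  -- Finitely many `w m` span: a finite-dimensional subspace is closed, so with the sequence it
  -- contains all of `C`.
  have htop : f N = ⊤ := by
    have hCN : (C : Set E) ⊆ ((f N).map S.subtype : Submodule ℝ E) := by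
      refine hdense.trans (closure_minimal ?_ (Submodule.closed_of_finiteDimensional _))
      rintro _ ⟨m, rfl⟩
      exact ⟨w' m, hmemN m, rfl⟩
    have hle : S ≤ (f N).map S.subtype := Submodule.span_le.2 hCN
    rw [eq_top_iff]
    rintro y -
    obtain ⟨y', hy', h⟩ := hle y.2
    rwa [Subtype.ext h] at hy'
  set ℓ : (Fin N → ℝ) →ₗ[ℝ] S := Fintype.linearCombination ℝ fun i : Fin N => w' i with hℓ
  have hℓ_apply : ∀ a, ((ℓ a : S) : E) = ∑ i : Fin N, a i • w i := fun a => by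
    simp [hℓ, Fintype.linearCombination_apply, hw']
  have hsurj : Function.Surjective ℓ := by
    rw [← LinearMap.range_eq_top, hℓ, Fintype.range_linearCombination, ← htop]
    congr 1
    ext y
    simp only [Set.mem_range, Set.mem_image, Set.mem_Iio]
    exact ⟨fun ⟨i, hi⟩ => ⟨i, i.2, hi⟩, fun ⟨i, hi, h⟩ => ⟨⟨i, hi⟩, h⟩⟩
  have hopen := (LinearMap.isOpenMap_of_finiteDimensional ℓ hsurj) (Set.univ.pi fun _ => Set.Ioi 0)
    (isOpen_set_pi Set.finite_univ fun _ _ => isOpen_Ioi)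
  -- The tail and `v` stay in `C`, so the open image of the positive orthant, translated by `r`, is
  -- a neighbourhood inside `C`.
  set r : E := (∑' m, c (m + N) • w (m + N)) + v with hr
  have hrC : r ∈ C := add_mem (tsum_mem_properCone C (fun m => C.smul_mem (hw _) (hc _).le)
    ((summable_nat_add_iff N (f := fun m => c m • w m)).2 hs)) hv
  have hz : (∑' m, c m • w m) + v = (∑ i : Fin N, c i • w i) + r := by
    rw [hr, ← hs.sum_add_tsum_nat_add N, Finset.sum_range, add_assoc]
  have hzC : (∑' m, c m • w m) + v ∈ C :=
    add_mem (tsum_mem_properCone C (fun m => C.smul_mem (hw _) (hc _).le) hs) hv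
  set r' : S := ⟨r, Submodule.subset_span hrC⟩ with hr'
  refine mem_intrinsicInterior_of_isOpen (O := (fun y : S => y - r') ⁻¹'
    (ℓ '' (Set.univ.pi fun _ => Set.Ioi 0))) hzC (hopen.preimage (by fun_prop)) ?_ ?_
  · refine ⟨fun i => c i, fun i _ => hc i, ?_⟩
    apply Subtype.ext
    rw [hℓ_apply]
    simp [hz, hr']
  · rintro y ⟨a, ha, hay⟩
    have h := congrArg (Subtype.val) hay
    rw [hℓ_apply] at h
    have hy : (y : E) = (∑ i : Fin N, a i • w i) + r := by
      rw [h]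
      simp [hr']
    rw [hy]
    exact add_mem (sum_mem fun i _ => C.smul_mem (hw i) (le_of_lt (ha i trivial))) hrC

end RelativeInterior

/-! ### Recovering a vector from its pairings with a dense sequence of a cone. -/

section Recovery

theorem exists_sub_of_mem_span (C : ProperCone ℝ E) {u : E}
    (hu : u ∈ Submodule.span ℝ (C : Set E)) : ∃ a ∈ C, ∃ b ∈ C, u = a - b := by
  induction hu using Submodule.span_induction with
  | mem x h => exact ⟨x, h, 0, C.zero_mem, (sub_zero x).symm⟩
  | zero => exact ⟨0, C.zero_mem, 0, C.zero_mem, (sub_zero 0).symm⟩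
  | add x y _ _ hx hy =>
    obtain ⟨a, ha, b, hb, rfl⟩ := hx
    obtain ⟨a', ha', b', hb', rfl⟩ := hy
    exact ⟨a + a', add_mem ha ha', b + b', add_mem hb hb', (add_sub_add_comm _ _ _ _).symm⟩
  | smul t x _ hx =>
    obtain ⟨a, ha, b, hb, rfl⟩ := hx
    rcases le_total 0 t with ht | ht
    · exact ⟨t • a, C.smul_mem ha ht, t • b, C.smul_mem hb ht, smul_sub _ _ _⟩
    · refine ⟨(-t) • b, C.smul_mem hb (neg_nonneg.2 ht), (-t) • a, C.smul_mem ha (neg_nonneg.2 ht), ?_⟩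
      rw [smul_sub, neg_smul, neg_smul]
      abel

variable [FiniteDimensional ℝ E]

/-- If `w` is dense in a closed convex cone with linear span `S` and `c m = ⟪w m, y⟫`, then this is
the squared norm of the orthogonal projection of `y + x` to `S`. -/
noncomputable def sqNormOfPairings (w : ℕ → E) (c : ℕ → ℝ) (x : E) : ℝ :=
  ⨆ p : ℕ × ℕ, 2 * (c p.1 - c p.2 + ⟪w p.1 - w p.2, x⟫_ℝ) - ‖w p.1 - w p.2‖ ^ 2

/-- With `t` the projection of `y + x`, each term equals `‖t‖² - ‖t - u‖²` for `u = w p.1 - w p.2`,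
and such `u` are dense in the span `C - C`. -/
theorem sqNormOfPairings_eq (C : ProperCone ℝ E) {w : ℕ → E} (hw : ∀ m, w m ∈ C)
    (hdense : (C : Set E) ⊆ closure (Set.range w)) (x y : E) :
    sqNormOfPairings w (fun m => ⟪w m, y⟫_ℝ) x =
      ‖(Submodule.span ℝ (C : Set E)).starProjection (y + x)‖ ^ 2 := by
  set S := Submodule.span ℝ (C : Set E) with hS
  set t := S.starProjection (y + x) with ht
  have htS : t ∈ S := Submodule.starProjection_apply_mem S _
  have hval : ∀ p : ℕ × ℕ, 2 * (⟪w p.1, y⟫_ℝ - ⟪w p.2, y⟫_ℝ + ⟪w p.1 - w p.2, x⟫_ℝ)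
      - ‖w p.1 - w p.2‖ ^ 2 = ‖t‖ ^ 2 - ‖t - (w p.1 - w p.2)‖ ^ 2 := fun p => by
    have hu : w p.1 - w p.2 ∈ S :=
      sub_mem (Submodule.subset_span (hw _)) (Submodule.subset_span (hw _))
    have h := Submodule.starProjection_inner_eq_zero (K := S) (y + x) _ hu
    rw [← ht, inner_sub_left, sub_eq_zero] at h
    rw [norm_sub_sq_real t, ← h, inner_add_left, real_inner_comm _ y, real_inner_comm _ x,
      ← inner_sub_left]
    ring
  have hb : ∀ p : ℕ × ℕ, 2 * (⟪w p.1, y⟫_ℝ - ⟪w p.2, y⟫_ℝ + ⟪w p.1 - w p.2, x⟫_ℝ)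
      - ‖w p.1 - w p.2‖ ^ 2 ≤ ‖t‖ ^ 2 := fun p => by
    rw [hval p]
    linarith [sq_nonneg ‖t - (w p.1 - w p.2)‖]
  refine le_antisymm (ciSup_le hb) (le_of_forall_pos_le_add fun ε hε => ?_)
  obtain ⟨a, ha, b, hb', hab⟩ := exists_sub_of_mem_span C htS
  obtain ⟨δ, hδ, hδε⟩ : ∃ δ : ℝ, 0 < δ ∧ (δ + δ) ^ 2 ≤ ε := by
    refine ⟨√ε / 2, by positivity, ?_⟩
    rw [add_halves, Real.sq_sqrt hε.le]
  obtain ⟨i, hi⟩ := Metric.mem_closure_range_iff.1 (hdense ha) δ hδ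
  obtain ⟨j, hj⟩ := Metric.mem_closure_range_iff.1 (hdense hb') δ hδ
  have h1 := le_ciSup (f := fun p : ℕ × ℕ =>
    2 * (⟪w p.1, y⟫_ℝ - ⟪w p.2, y⟫_ℝ + ⟪w p.1 - w p.2, x⟫_ℝ) - ‖w p.1 - w p.2‖ ^ 2)
    ⟨‖t‖ ^ 2, by rintro _ ⟨p, rfl⟩; exact hb p⟩ (i, j)
  have h2 : ‖t - (w i - w j)‖ ^ 2 ≤ ε := by
    refine le_trans (pow_le_pow_left₀ (norm_nonneg _) ?_ 2) hδε
    rw [hab, sub_sub_sub_comm, ← dist_eq_norm]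
    rw [dist_eq_norm] at hi hj
    rw [dist_eq_norm]
    exact (norm_sub_le _ _).trans (add_le_add hi.le hj.le)
  have h3 := hval (i, j)
  simp only [sqNormOfPairings] at h1 h3 ⊢
  linarith

/-- The vector of the linear span of a closed convex cone with given pairings with a dense sequence
of the cone. -/
noncomputable def vecOfPairings (w : ℕ → E) (c : ℕ → ℝ) : E :=
  ∑ i, ((sqNormOfPairings w c (stdOrthonormalBasis ℝ E i) -
    sqNormOfPairings w c (-stdOrthonormalBasis ℝ E i)) / 4) • stdOrthonormalBasis ℝ E i

/-- Polarization of the squared norms of the projections of `y ± e i` yields the coordinates. -/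
theorem vecOfPairings_eq (C : ProperCone ℝ E) {w : ℕ → E} (hw : ∀ m, w m ∈ C)
    (hdense : (C : Set E) ⊆ closure (Set.range w)) (y : E) :
    vecOfPairings w (fun m => ⟪w m, y⟫_ℝ) =
      (Submodule.span ℝ (C : Set E)).starProjection y := by
  rw [vecOfPairings]
  conv_rhs => rw [← (stdOrthonormalBasis ℝ E).sum_repr'
    ((Submodule.span ℝ (C : Set E)).starProjection y)]
  refine Finset.sum_congr rfl fun i _ => ?_
  congr 1
  rw [sqNormOfPairings_eq C hw hdense, sqNormOfPairings_eq C hw hdense, map_add, map_add, map_neg,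
    ← sub_eq_add_neg, norm_add_sq_real, norm_sub_sq_real]
  have h := Submodule.starProjection_inner_eq_zero (K := Submodule.span ℝ (C : Set E))
    (stdOrthonormalBasis ℝ E i) _ (Submodule.starProjection_apply_mem
      (Submodule.span ℝ (C : Set E)) y)
  rw [inner_sub_left, sub_eq_zero] at h
  rw [h, real_inner_comm (Submodule.starProjection _ y)]
  ring

theorem measurable_vecOfPairings [MeasurableSpace E] [BorelSpace E] {α : Type*}
    [MeasurableSpace α] {w : ℕ → α → E} {c : ℕ → α → ℝ} (hw : ∀ m, Measurable (w m))
    (hc : ∀ m, Measurable (c m)) :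
    Measurable fun a => vecOfPairings (fun m => w m a) (fun m => c m a) := by
  have h : ∀ x : E, Measurable fun a => sqNormOfPairings (fun m => w m a) (fun m => c m a) x :=
    fun x => Measurable.iSup fun p => by
      have h1 := (hw p.1).sub (hw p.2)
      exact ((((hc p.1).sub (hc p.2)).add (h1.inner measurable_const)).const_mul 2).sub
        (h1.norm.pow_const 2)
  exact Finset.measurable_sum _ fun i _ => (((h _).sub (h _)).div_const 4).smul_const _

/-- The residual is orthogonal to the polar cone, so the bipolar theorem puts it and its negative in
`K`. -/
theorem sub_starProjection_mem [CompleteSpace E] (K : ProperCone ℝ E) (y : E) :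
    y - (Submodule.span ℝ (ProperCone.innerDual (K : Set E) : Set E)).starProjection y ∈ K ∧
    (Submodule.span ℝ (ProperCone.innerDual (K : Set E) : Set E)).starProjection y - y ∈ K := by
  have h : ∀ v ∈ ProperCone.innerDual (K : Set E), ⟪v, y - (Submodule.span ℝ
      (ProperCone.innerDual (K : Set E) : Set E)).starProjection y⟫_ℝ = 0 := fun v hv => by
    rw [real_inner_comm]
    exact Submodule.starProjection_inner_eq_zero _ _ (Submodule.subset_span hv)
  have hmem : ∀ u : E, (∀ v ∈ ProperCone.innerDual (K : Set E), 0 ≤ ⟪v, u⟫_ℝ) → u ∈ K :=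
    fun u hu => by
      rw [← ProperCone.innerDual_innerDual K, ProperCone.mem_innerDual]
      exact hu
  refine ⟨hmem _ fun v hv => (h v hv).ge, hmem _ fun v hv => ?_⟩
  rw [← neg_sub, inner_neg_right, h v hv, neg_zero]

end Recovery

end Cone

end VectorMarket

namespace VectorMarket

/-! ### Extended vectors, locality of market models, and selections of the polar cone. -/

section ExtVec

variable {n : ℕ}

theorem measurable_extVec_iff {β : Type*} [MeasurableSpace β] {f : ExtVec n → β} :
    Measurable f ↔ Measurable fun x : Vec n => f (x : ExtVec n) :=
  Iff.rfl

theorem measurable_extVec_coe : Measurable fun x : Vec n => (x : ExtVec n) :=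
  fun _ hs => hs

theorem pairing_coe (z y : Vec n) :
    pairing z (y : ExtVec n) = ((inner ℝ z y : ℝ) : EReal) :=
  rfl

theorem pairing_bot (z : Vec n) : pairing z ⊥ = ⊥ :=
  rfl

theorem pairing_eq_bot_iff {z : Vec n} {x : ExtVec n} : pairing z x = ⊥ ↔ x = ⊥ := by
  cases x using WithBot.recBotCoe with
  | bot => simp [pairing_bot]
  | coe y => simp [pairing_coe]

theorem Measurable.pairing {Ω : Type*} [MeasurableSpace Ω] {Z : Ω → Vec n} {X : Ω → ExtVec n}
    (hZ : Measurable Z) (hX : Measurable X) : Measurable fun ω => pairing (Z ω) (X ω) := by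
  classical
  have hbot : MeasurableSet {x : ExtVec n | x = ⊥} := by
    rw [measurableSet_extVec_iff]
    simp
  have hval : Measurable fun x : ExtVec n => x.unbotD 0 :=
    measurable_extVec_iff.2 measurable_id
  have h : (fun ω => VectorMarket.pairing (Z ω) (X ω)) = fun ω => if X ω = ⊥ then (⊥ : EReal) else
      ((inner ℝ (Z ω) ((X ω).unbotD 0) : ℝ) : EReal) := by
    funext ω
    cases X ω using WithBot.recBotCoe with
    | bot => simp [pairing_bot]
    | coe y => simp [pairing_coe]
  rw [h]
  exact Measurable.ite (hX hbot) measurable_const (hZ.inner (hval.comp hX)).coe_real_ereal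

theorem coneEquiv_bot (K : ProperCone ℝ (Vec n)) : ConeEquiv K ⊥ ⊥ :=
  ⟨trivial, trivial⟩

theorem coneEquiv_coe {K : ProperCone ℝ (Vec n)} {a b : Vec n} (h : a - b ∈ K) (h' : b - a ∈ K) :
    ConeEquiv K (a : ExtVec n) (b : ExtVec n) :=
  ⟨h, h'⟩

end ExtVec

section MarketModel

variable {Ω : Type*} {mΩ : MeasurableSpace Ω} {T : ℕ} {ℱ : Filtration (Fin (T + 1)) mΩ} {d n : ℕ}

/-- The strategy with the positions of `ϑ'` before time `j` and those of `ϑ` from time `j` on. -/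
def Strategy.splice (ϑ' ϑ : Strategy ℱ d) (j : ℕ) : Strategy ℱ d where
  toFun := fun ω s => if (s : ℕ) < j then ϑ'.toFun ω s else ϑ.toFun ω s
  adapted := fun s => by
    split_ifs
    · exact ϑ'.adapted s
    · exact ϑ.adapted s

/-- Positions are exchanged one time at a time: consecutive splices have the same localization to
the event that the two positions at time `t` agree. -/
theorem MarketModel.isLocal {P : Measure Ω} (V : MarketModel P ℱ d n) : IsLocal P V.toFun := by
  intro ϑ ϑ'
  have hstep : ∀ t : Fin T, ∀ᵐ ω ∂P, ϑ.toFun ω t = ϑ'.toFun ω t →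
      V.toFun (ϑ'.splice ϑ t) ω = V.toFun (ϑ'.splice ϑ (t + 1)) ω := fun t => by
    have hA : MeasurableSet[ℱ t.castSucc] ((fun ω => ϑ.toFun ω t - ϑ'.toFun ω t) ⁻¹' {0}) :=
      (measurable_sub.comp ((ϑ.adapted t).prodMk (ϑ'.adapted t))) (measurableSet_singleton 0)
    have heq : (ϑ'.splice ϑ t).localize t _ hA = (ϑ'.splice ϑ (t + 1)).localize t _ hA := by
      ext1
      funext ω s
      by_cases hs : s = t
      · subst hs
        simp only [Strategy.localize, if_true, Strategy.splice, Set.indicator, Set.mem_preimage,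
          Set.mem_singleton_iff, sub_eq_zero, lt_irrefl, Nat.lt_succ_self, if_false]
        split_ifs with h
        · exact h
        · rfl
      · have hst : (s : ℕ) < t + 1 ↔ (s : ℕ) < t := by
          have := Fin.val_ne_of_ne hs
          omega
        simp only [Strategy.localize, Strategy.splice, hs, hst, if_false]
    filter_upwards [V.locality t _ hA (ϑ'.splice ϑ t), V.locality t _ hA (ϑ'.splice ϑ (t + 1))]
      with ω h1 h2 h
    have hω : ω ∈ (fun ω => ϑ.toFun ω t - ϑ'.toFun ω t) ⁻¹' {0} := sub_eq_zero.2 h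
    rw [h1 hω, h2 hω, heq]
  filter_upwards [ae_all_iff.2 hstep] with ω hω h
  have hind : ∀ j ≤ T, V.toFun (ϑ'.splice ϑ 0) ω = V.toFun (ϑ'.splice ϑ j) ω := fun j => by
    induction j with
    | zero => exact fun _ => rfl
    | succ j ih => exact fun hj =>
        (ih (Nat.le_of_succ_le hj)).trans (hω ⟨j, hj⟩ (congrFun h _))
  have h0 : ϑ'.splice ϑ 0 = ϑ := by
    ext1
    funext ω s
    simp [Strategy.splice]
  have hT : ϑ'.splice ϑ T = ϑ' := by
    ext1
    funext ω s
    simp [Strategy.splice]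
  rw [← h0, hind T le_rfl, hT]

/-- Measurable selections of the relative interior of the polar cone whose differences with a fixed
one among them are dense in the polar cone. -/
theorem exists_measurableSelections {K : Ω → ProperCone ℝ (Vec n)}
    (hK : MeasurableCorrespondence fun ω => (K ω : Set (Vec n))) :
    ∃ (Z : Ω → Vec n) (w : ℕ → Ω → Vec n), (∀ m, Measurable (w m)) ∧
      (∀ m ω, w m ω ∈ ProperCone.innerDual (K ω : Set (Vec n))) ∧
      (∀ ω, (ProperCone.innerDual (K ω : Set (Vec n)) : Set (Vec n)) ⊆
        closure (Set.range fun m => w m ω)) ∧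
      IsMeasurableSelection (fun ω => intrinsicInterior ℝ (posPolar (K ω))) Z ∧
      ∀ m, IsMeasurableSelection (fun ω => intrinsicInterior ℝ (posPolar (K ω)))
        fun ω => Z ω + w m ω := by
  set q : ℕ → Vec n := TopologicalSpace.denseSeq (Vec n)
  -- Since `‖w m ω‖ ≤ 2 ‖q m‖`, these weights make the series summable for every `ω`.
  set c : ℕ → ℝ := fun m => (1 / 2) ^ m / (1 + ‖q m‖) with hc
  have hc0 : ∀ m, 0 < c m := fun m => by positivity
  set w : ℕ → Ω → Vec n := fun m ω => dualProj (K ω) (q m)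
  have hwm : ∀ m, Measurable (w m) := fun m => measurable_dualProj hK _
  have hw : ∀ m ω, w m ω ∈ ProperCone.innerDual (K ω : Set (Vec n)) := fun m ω =>
    dualProj_mem _ _
  have hdense : ∀ ω, (ProperCone.innerDual (K ω : Set (Vec n)) : Set (Vec n)) ⊆
      closure (Set.range fun m => w m ω) := fun ω =>
    innerDual_subset_closure_range_dualProj _ (TopologicalSpace.denseRange_denseSeq _)
  have hs : ∀ ω, Summable fun m => c m • w m ω := fun ω => by
    refine Summable.of_norm_bounded
      (summable_geometric_of_lt_one (by norm_num) (by norm_num : (1 / 2 : ℝ) < 1) |>.mul_left 2)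
      fun m => ?_
    rw [norm_smul, Real.norm_of_nonneg (hc0 m).le]
    have h1 : ‖w m ω‖ ≤ 2 * (1 + ‖q m‖) := by
      have := norm_dualProj_le (K ω) (q m)
      change ‖dualProj (K ω) (q m)‖ ≤ _
      linarith
    refine (mul_le_mul_of_nonneg_left h1 (hc0 m).le).trans (le_of_eq ?_)
    simp only [hc]
    field_simp
  have hZm : Measurable fun ω => ∑' m, c m • w m ω :=
    measurable_of_tendsto_metrizable
      (f := fun N ω => ∑ m ∈ Finset.range N, c m • w m ω)
      (fun N => Finset.measurable_sum _ fun m _ => (hwm m).const_smul (c m))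
      (tendsto_pi_nhds.2 fun ω => (hs ω).hasSum.tendsto_sum_nat)
  refine ⟨fun ω => ∑' m, c m • w m ω, w, hwm, hw, hdense, ⟨hZm, fun ω => ?_⟩,
    fun m => ⟨hZm.add (hwm m), fun ω => ?_⟩⟩
  · have h := tsum_add_mem_intrinsicInterior _ (fun m => hw m ω) (hdense ω) hc0 (hs ω)
      (zero_mem _)
    rwa [add_zero] at h
  · exact tsum_add_mem_intrinsicInterior _ (fun m => hw m ω) (hdense ω) hc0 (hs ω) (hw m ω)

end MarketModel

end VectorMarket

theorem mainTheorem7 {Ω : Type*} [mΩ : MeasurableSpace Ω] (P : Measure Ω) [IsProbabilityMeasure P]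
    (d n T : ℕ) (hT : 0 < T) (ℱ : Filtration (Fin (T + 1)) mΩ)
    (K : Ω → ProperCone ℝ (VectorMarket.Vec n))
    (hK_meas : VectorMarket.MeasurableCorrespondence
      (fun ω => (K ω : Set (VectorMarket.Vec n))))
    (hK_int : ∀ᵐ ω ∂P, (interior (K ω : Set (VectorMarket.Vec n))).Nonempty)
    (Vhat : VectorMarket.MarketModel P ℱ d n)
    (hV : Vhat.IsUpperSemicontinuous K) :
    ∃ V : Ω × VectorMarket.Path d T → VectorMarket.ExtVec n,
      Measurable V ∧
      ∀ ϑ : VectorMarket.Strategy ℱ d,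
        ∀ᵐ ω ∂P, VectorMarket.ConeEquiv (K ω) (Vhat.toFun ϑ ω) (V (ω, ϑ.toFun ω)) := by
  classical
  obtain ⟨Z, w, hwm, hw, hdense, hZ, hZw⟩ := VectorMarket.exists_measurableSelections hK_meas
  have hscalar : ∀ Y : Ω → VectorMarket.Vec n, VectorMarket.IsMeasurableSelection
      (fun ω => intrinsicInterior ℝ (VectorMarket.posPolar (K ω))) Y →
      ∃ V : Ω × VectorMarket.Path d T → EReal, Measurable V ∧ ∀ ϑ : VectorMarket.Strategy ℱ d,
        ∀ᵐ ω ∂P, V (ω, ϑ.toFun ω) = VectorMarket.pairing (Y ω) (Vhat.toFun ϑ ω) := fun Y hY => by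
    refine (hV Y hY).exists_measurable (fun ϑ ϑ' => ?_)
      fun ϑ => VectorMarket.Measurable.pairing hY.1 (Vhat.measurable ϑ)
    filter_upwards [Vhat.isLocal ϑ ϑ'] with ω hω h
    rw [hω h]
  obtain ⟨V₀, hV₀m, hV₀⟩ := hscalar Z hZ
  choose V hVm hV' using fun m => hscalar _ (hZw m)
  -- Along a strategy with finite value `y`, the difference `V m - V₀` is `⟨Z + w m, y⟩ - ⟨Z, y⟩ =
  -- ⟨w m, y⟩`.
  refine ⟨fun p => if V₀ p = ⊥ then ⊥ else
    ((VectorMarket.vecOfPairings (fun m => w m p.1) fun m => (V m p).toReal - (V₀ p).toReal :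
      VectorMarket.Vec n) : VectorMarket.ExtVec n), ?_, fun ϑ => ?_⟩
  · refine Measurable.ite (hV₀m (measurableSet_singleton ⊥)) measurable_const
      (VectorMarket.measurable_extVec_coe.comp
        (VectorMarket.measurable_vecOfPairings (fun m => (hwm m).comp measurable_fst)
          fun m => (hVm m).ereal_toReal.sub hV₀m.ereal_toReal))
  · filter_upwards [hV₀ ϑ, ae_all_iff.2 fun m => hV' m ϑ] with ω h0 h
    simp only [h0, h]
    cases Vhat.toFun ϑ ω using WithBot.recBotCoe with
    | bot =>
      rw [if_pos (VectorMarket.pairing_bot _)]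
      exact VectorMarket.coneEquiv_bot _
    | coe y =>
      have hc : (fun m => (VectorMarket.pairing (Z ω + w m ω)
          (y : VectorMarket.ExtVec n)).toReal -
          (VectorMarket.pairing (Z ω) (y : VectorMarket.ExtVec n)).toReal) =
          fun m => (inner ℝ (w m ω) y : ℝ) := by
        funext m
        rw [VectorMarket.pairing_coe, VectorMarket.pairing_coe, EReal.toReal_coe,
          EReal.toReal_coe, inner_add_left, add_sub_cancel_left]
      rw [if_neg (by simp [VectorMarket.pairing_eq_bot_iff]), hc,
        VectorMarket.vecOfPairings_eq _ (fun m => hw m ω) (hdense ω)]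
      obtain ⟨h1, h2⟩ := VectorMarket.sub_starProjection_mem (K ω) y
      exact VectorMarket.coneEquiv_coe h1 h2
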